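/- Call a group virtually cyclic if it has a cyclic subgroup of finite index (so every finite group is virtually cyclic). A group $G$ is said to have BVC if there is a finite set $\{V_1,\dots,V_n\}$ of virtually cyclic subgroups of $G$ such that every virtually cyclic subgroup of $G$ is conjugate in $G$ to a subgroup of some $V_i$. Let $A$ and $B$ be nontrivial groups and let $G = A * B$ be their free product. Then $G$ has BVC if and only if $G$ is virtually cyclic. -/

import Mathlib

/-- A group is virtually cyclic if it has a cyclic subgroup of finite index
(in particular every finite group is virtually cyclic). -/
def IsVirtuallyCyclic (G : Type*) [Group G] : Prop :=
  ∃ C : Subgroup G, IsCyclic C ∧ C.FiniteIndex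

/-- The property BVC: there is a finite set `S` of virtually cyclic subgroups of `G` such that
every virtually cyclic subgroup `H` of `G` is conjugate to a subgroup of some member of `S`. -/
def HasBVC (G : Type*) [Group G] : Prop :=
  ∃ S : Set (Subgroup G), S.Finite ∧ (∀ V ∈ S, IsVirtuallyCyclic V) ∧
    ∀ H : Subgroup G, IsVirtuallyCyclic H →
      ∃ V ∈ S, ∃ g : G, H.map (MulAut.conj g).toMonoidHom ≤ V

/-! If one factor has nontrivial `b ≠ c` and the other has `a ≠ 1`, set `g n = (ab)^n ac`.
Conjugation changes a syllable count by a bounded amount, so the linear growth rate of the count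
along powers is a conjugacy invariant. Comparing rates shows that no positive power of `g n` is
conjugate to a power of `g m` for `n ≠ m` (`alternating_pow_not_conj`). BVC forbids this by
pigeonhole (`HasBVC.exists_conj_pow`). So both factors have order 2 and `G` is infinite dihedral.
Conversely, a virtually cyclic `G` is its own single `V`. -/

namespace Monoid.CoprodI

variable {ι : Type*} {M : ι → Type*}

/-! ### Syllable weights of normal forms -/

namespace Word

/-- The sum of the weights `f` of the syllables of a word. -/
def weight [∀ i, Monoid (M i)] (f : (Σ i, M i) → ℕ) (w : Word M) : ℕ :=
  (w.toList.map f).sum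

theorem weight_empty [∀ i, Monoid (M i)] (f : (Σ i, M i) → ℕ) :
    weight f (empty : Word M) = 0 := rfl

theorem weight_cons [∀ i, Monoid (M i)] (f : (Σ i, M i) → ℕ) {i : ι} (m : M i) (w : Word M)
    (hw : w.fstIdx ≠ some i) (hm : m ≠ 1) :
    weight f (cons m w hw hm) = f ⟨i, m⟩ + weight f w := by
  simp [weight, cons]

variable [∀ i, Group (M i)] [∀ i, DecidableEq (M i)]

theorem weight_rcons_bounds {f : (Σ i, M i) → ℕ} (hf : ∀ s, f s ≤ 1) {i : ι} (p : Pair M i) :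
    weight f p.tail ≤ weight f (rcons p) ∧ weight f (rcons p) ≤ weight f p.tail + 1 := by
  unfold rcons
  split_ifs with h
  · simp
  · rw [weight_cons]
    have := hf ⟨i, p.head⟩
    omega

variable [DecidableEq ι]

/-- Only a leading syllable in `M i` can change; both words share the same tail. -/
theorem weight_of_smul_le {f : (Σ i, M i) → ℕ} (hf : ∀ s, f s ≤ 1) {i : ι} (m : M i)
    (w : Word M) : weight f (of m • w) ≤ weight f w + 1 := by
  have h₁ := weight_rcons_bounds hf { equivPair i w with head := m * (equivPair i w).head }
  have h₂ := weight_rcons_bounds hf (equivPair i w)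
  have h₃ : rcons (equivPair i w) = w := by rw [← equivPair_symm, Equiv.symm_apply_apply]
  rw [h₃] at h₂
  rw [of_smul_def]
  exact h₁.2.trans (Nat.add_le_add_right h₂.1 1)

theorem exists_weight_smul_le {f : (Σ i, M i) → ℕ} (hf : ∀ s, f s ≤ 1) (x : CoprodI M) :
    ∃ K, ∀ w : Word M, weight f (x • w) ≤ weight f w + K := by
  induction x using CoprodI.induction_on with
  | one => exact ⟨0, fun w => by simp⟩
  | of i m => exact ⟨1, weight_of_smul_le hf m⟩
  | mul x y hx hy =>
    obtain ⟨K, hK⟩ := hx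
    obtain ⟨L, hL⟩ := hy
    refine ⟨L + K, fun w => ?_⟩
    rw [mul_smul]
    have := hK (y • w)
    have := hL w
    omega

end Word

variable [∀ i, Group (M i)]

theorem NeWord.toList_inv {i j : ι} (w : NeWord M i j) :
    w.inv.toList = (w.toList.map fun s => (⟨s.1, s.2⁻¹⟩ : Σ i, M i)).reverse := by
  induction w with
  | singleton x hx => simp [NeWord.inv, NeWord.toList]
  | append w₁ h w₂ h₁ h₂ => simp [NeWord.inv, NeWord.toList, h₁, h₂]

variable [DecidableEq ι] [∀ i, DecidableEq (M i)]

/-- The sum of the weights of the syllables of the normal form of an element. -/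
def weight (f : (Σ i, M i) → ℕ) (x : CoprodI M) : ℕ :=
  Word.weight f (x • (Word.empty : Word M))

theorem weight_prod (f : (Σ i, M i) → ℕ) (w : Word M) : weight f w.prod = w.weight f := by
  have h : w.prod • (Word.empty : Word M) = w := Word.equiv.apply_symm_apply w
  rw [weight, h]

/-- Inversion reverses the normal form and inverts each syllable. This turns bounds for left
multiplication into bounds for right multiplication. -/
theorem weight_inv (f : (Σ i, M i) → ℕ) (x : CoprodI M) :
    weight f x⁻¹ = weight (fun s => f ⟨s.1, s.2⁻¹⟩) x := by
  obtain ⟨w, rfl⟩ : ∃ w : Word M, w.prod = x := ⟨_, Word.equiv.symm_apply_apply x⟩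
  by_cases hw : w = Word.empty
  · subst hw
    simp [weight, Word.weight_empty]
  · obtain ⟨i, j, v, rfl⟩ := NeWord.of_word w hw
    have h : (v.toWord.prod)⁻¹ = v.inv.toWord.prod := (NeWord.inv_prod v).symm
    rw [h, weight_prod, weight_prod]
    simp only [Word.weight, NeWord.toWord, NeWord.toList_inv, List.map_reverse,
      List.sum_reverse, List.map_map]
    rfl

theorem exists_weight_mul_left_le {f : (Σ i, M i) → ℕ} (hf : ∀ s, f s ≤ 1) (x : CoprodI M) :
    ∃ K, ∀ y, weight f (x * y) ≤ weight f y + K := by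
  obtain ⟨K, hK⟩ := Word.exists_weight_smul_le hf x
  refine ⟨K, fun y => ?_⟩
  rw [weight, mul_smul]
  exact hK _

theorem exists_weight_mul_right_le {f : (Σ i, M i) → ℕ} (hf : ∀ s, f s ≤ 1) (x : CoprodI M) :
    ∃ K, ∀ y, weight f (y * x) ≤ weight f y + K := by
  obtain ⟨K, hK⟩ := exists_weight_mul_left_le (f := fun s => f ⟨s.1, s.2⁻¹⟩)
    (fun s => hf _) x⁻¹
  refine ⟨K, fun y => ?_⟩
  have h := hK y⁻¹
  rw [← mul_inv_rev, weight_inv, weight_inv] at h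
  simpa using h

theorem exists_weight_conj_le {f : (Σ i, M i) → ℕ} (hf : ∀ s, f s ≤ 1) (x : CoprodI M) :
    ∃ K, ∀ y, weight f (x * y * x⁻¹) ≤ weight f y + K := by
  obtain ⟨K, hK⟩ := exists_weight_mul_left_le hf x
  obtain ⟨L, hL⟩ := exists_weight_mul_right_le hf x⁻¹
  refine ⟨K + L, fun y => ?_⟩
  have := hK y
  have := hL (x * y)
  omega

/-- If the weights of the powers of `g` and `h` grow linearly and `g` is conjugate to `h`, then
the growth of `g` is at most that of `h`. -/
theorem growth_le_of_conj {f : (Σ i, M i) → ℕ} (hf : ∀ s, f s ≤ 1) {g h x : CoprodI M}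
    {r s : ℕ} (hg : ∀ N, weight f (g ^ N) = N * r) (hh : ∀ N, weight f (h ^ N) = N * s)
    (hx : g = x * h * x⁻¹) : r ≤ s := by
  obtain ⟨K, hK⟩ := exists_weight_conj_le hf x
  by_contra! hlt
  -- At this power a rate gap of at least 1 already exceeds the error `K`.
  have h₁ := hK (h ^ (K + 1))
  rw [← conj_pow, ← hx, hg, hh] at h₁
  nlinarith

theorem growth_eq_of_conj {f : (Σ i, M i) → ℕ} (hf : ∀ s, f s ≤ 1) {g h x : CoprodI M}
    {r s : ℕ} (hg : ∀ N, weight f (g ^ N) = N * r) (hh : ∀ N, weight f (h ^ N) = N * s)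
    (hx : g = x * h * x⁻¹) : r = s :=
  le_antisymm (growth_le_of_conj hf hg hh hx)
    (growth_le_of_conj hf (x := x⁻¹) hh hg (by rw [hx]; group))

/-! ### Alternating words -/

/-- Nothing cancels, and the hypothesis on the first syllable is reproduced, so the step iterates.
-/
theorem alternating_smul {i j : ι} (hij : i ≠ j) {a : M i} {b : M j} (ha : a ≠ 1) (hb : b ≠ 1)
    (f : (Σ i, M i) → ℕ) (w : Word M)
    (hw : w.fstIdx ≠ some j) :
    ((of a * of b) • w).fstIdx ≠ some j ∧
      Word.weight f ((of a * of b) • w) = f ⟨i, a⟩ + f ⟨j, b⟩ + Word.weight f w := by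
  have h : (Word.cons b w hw hb).fstIdx ≠ some i := by
    simpa [Word.fstIdx_cons] using hij.symm
  have e : (of a * of b) • w = Word.cons a (Word.cons b w hw hb) h ha := by
    rw [mul_smul, Word.cons_eq_smul, Word.cons_eq_smul]
  rw [e, Word.weight_cons, Word.weight_cons, Word.fstIdx_cons]
  exact ⟨by simpa using hij, by ring⟩

theorem pow_smul_weight {f : (Σ i, M i) → ℕ} {j : ι} {g : CoprodI M} {r : ℕ}
    (hg : ∀ w : Word M, w.fstIdx ≠ some j →
      (g • w).fstIdx ≠ some j ∧ Word.weight f (g • w) = r + Word.weight f w)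
    (n : ℕ) (w : Word M) (hw : w.fstIdx ≠ some j) :
    (g ^ n • w).fstIdx ≠ some j ∧ Word.weight f (g ^ n • w) = n * r + Word.weight f w := by
  induction n with
  | zero => simpa using hw
  | succ n ih =>
    rw [pow_succ', mul_smul]
    obtain ⟨h₁, h₂⟩ := hg _ ih.1
    exact ⟨h₁, by rw [h₂, ih.2]; ring⟩

theorem weight_alternating_pow {i j : ι} (hij : i ≠ j) {a : M i} {b c : M j}
    (ha : a ≠ 1) (hb : b ≠ 1) (hc : c ≠ 1) (f : (Σ i, M i) → ℕ) (n N : ℕ) :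
    weight f (((of a * of b) ^ n * (of a * of c)) ^ N) =
      N * (n * (f ⟨i, a⟩ + f ⟨j, b⟩) + (f ⟨i, a⟩ + f ⟨j, c⟩)) := by
  have key : ∀ w : Word M, w.fstIdx ≠ some j →
      (((of a * of b) ^ n * (of a * of c)) • w).fstIdx ≠ some j ∧
        Word.weight f (((of a * of b) ^ n * (of a * of c)) • w) =
          (n * (f ⟨i, a⟩ + f ⟨j, b⟩) + (f ⟨i, a⟩ + f ⟨j, c⟩)) + Word.weight f w := by
    intro w hw
    obtain ⟨h₁, h₂⟩ := alternating_smul hij ha hc f w hw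
    obtain ⟨h₃, h₄⟩ := pow_smul_weight (alternating_smul hij ha hb f) n _ h₁
    rw [mul_smul]
    exact ⟨h₃, by rw [h₄, h₂]; ring⟩
  rw [weight, (pow_smul_weight key N Word.empty (by simp [Word.fstIdx, Word.empty])).2,
    Word.weight_empty, add_zero]

theorem alternating_pow_not_conj {i j : ι} (hij : i ≠ j) {a : M i} {b c : M j}
    (ha : a ≠ 1) (hb : b ≠ 1) (hc : c ≠ 1) (hbc : b ≠ c) {n m P Q : ℕ} (hP : P ≠ 0)
    {x : CoprodI M}
    (hx : ((of a * of b) ^ n * (of a * of c)) ^ P =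
      x * ((of a * of b) ^ m * (of a * of c)) ^ Q * x⁻¹) : n = m := by
  classical
  have growth : ∀ (f : (Σ i, M i) → ℕ) (n P N : ℕ),
      weight f ((((of a * of b) ^ n * (of a * of c)) ^ P) ^ N) =
        N * (P * (n * (f ⟨i, a⟩ + f ⟨j, b⟩) + (f ⟨i, a⟩ + f ⟨j, c⟩))) := by
    intro f n P N
    rw [← pow_mul, weight_alternating_pow hij ha hb hc]
    ring
  -- Counting all syllables gives `P(2n+2) = Q(2m+2)`; counting only the syllables `c` gives `P =
  -- Q`.
  have h₁ := growth_eq_of_conj (f := fun _ => 1) (fun _ => le_rfl) (growth _ n P)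
    (growth _ m Q) hx
  have h₂ := growth_eq_of_conj (f := fun s => if s = ⟨j, c⟩ then 1 else 0)
    (fun s => by split_ifs <;> simp) (growth _ n P) (growth _ m Q) hx
  have hac : (⟨i, a⟩ : Σ i, M i) ≠ ⟨j, c⟩ := fun h => hij (congrArg Sigma.fst h)
  have hbc' : (⟨j, b⟩ : Σ i, M i) ≠ ⟨j, c⟩ := fun h => hbc (by simpa using h)
  simp only [hac, hbc', if_false, if_true, add_zero, mul_zero, zero_add, mul_one] at h₂
  subst h₂
  have := Nat.eq_of_mul_eq_mul_left (Nat.pos_of_ne_zero hP) h₁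
  omega

theorem alternating_pow_ne_one {i j : ι} (hij : i ≠ j) {a : M i} {b c : M j}
    (ha : a ≠ 1) (hb : b ≠ 1) (hc : c ≠ 1) {n P : ℕ} (hP : P ≠ 0) :
    ((of a * of b) ^ n * (of a * of c)) ^ P ≠ 1 := by
  intro h
  have h₁ := weight_alternating_pow hij ha hb hc (fun _ => 1) n P
  rw [h, weight, one_smul, Word.weight_empty] at h₁
  simp [hP] at h₁

end Monoid.CoprodI

/-! ### Consequences of BVC -/

/-- Every element of a virtually cyclic group has a nontrivial power in a fixed cyclic subgroup. -/
theorem IsVirtuallyCyclic.exists_pow_eq_zpow {V : Type*} [Group V] (hV : IsVirtuallyCyclic V) :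
    ∃ t : V, ∀ v : V, ∃ p : ℕ, p ≠ 0 ∧ ∃ k : ℤ, v ^ p = t ^ k := by
  obtain ⟨C, hC, hfin⟩ := hV
  obtain ⟨t, ht⟩ := hC.exists_generator
  refine ⟨t, fun v => ?_⟩
  obtain ⟨p, hp, -, hmem⟩ := Subgroup.exists_pow_mem_of_index_ne_zero hfin.index_ne_zero v
  obtain ⟨k, hk⟩ := Subgroup.mem_zpowers_iff.1 (ht ⟨v ^ p, hmem⟩)
  exact ⟨p, hp.ne', k, by simpa using (congrArg Subtype.val hk).symm⟩

theorem isVirtuallyCyclic_zpowers {G : Type*} [Group G] (g : G) :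
    IsVirtuallyCyclic (Subgroup.zpowers g) :=
  ⟨⊤, Subgroup.isCyclic ⊤, inferInstance⟩

/-- In a group with BVC, among the members of any sequence of elements of infinite order, two have
conjugate positive powers. -/
theorem HasBVC.exists_conj_pow {G : Type*} [Group G] (hG : HasBVC G) (g : ℕ → G)
    (hg : ∀ n p, p ≠ 0 → g n ^ p ≠ 1) :
    ∃ n m, n ≠ m ∧ ∃ P Q : ℕ, P ≠ 0 ∧ ∃ x, g n ^ P = x * g m ^ Q * x⁻¹ := by
  obtain ⟨S, hS, hVC, hsub⟩ := hG
  have hex : ∀ n, ∃ V : S, ∃ y : G, y * g n * y⁻¹ ∈ V.1 := fun n => by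
    obtain ⟨V, hV, y, hy⟩ := hsub _ (isVirtuallyCyclic_zpowers (g n))
    exact ⟨⟨V, hV⟩, y, hy ⟨g n, Subgroup.mem_zpowers _, rfl⟩⟩
  choose V y hy using hex
  choose t ht using fun W : S => (hVC W.1 W.2).exists_pow_eq_zpow
  choose p hp k hk using fun n => ht (V n) ⟨_, hy n⟩
  have hk' : ∀ n, y n * g n ^ p n * (y n)⁻¹ = (t (V n) : G) ^ k n := fun n => by
    rw [← conj_pow]
    simpa using congrArg Subtype.val (hk n)
  have hk0 : ∀ n, k n ≠ 0 := fun n h0 => hg n (p n) (hp n) <| by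
    simpa [h0] using hk' n
  have := hS.to_subtype
  -- Recording the sign of `k n` ensures that the common power is a positive power of both elements.
  obtain ⟨n, m, hne, heq⟩ :=
    Finite.exists_ne_map_eq_of_infinite fun n => (V n, decide (0 < k n))
  obtain ⟨hVnm, hsign⟩ := Prod.mk.inj heq
  have hsign' : 0 < k n ↔ 0 < k m := by simpa using hsign
  refine ⟨n, m, hne, p n * (k m).natAbs, p m * (k n).natAbs,
    mul_ne_zero (hp n) (Int.natAbs_ne_zero.2 (hk0 m)), (y n)⁻¹ * y m, ?_⟩
  have hmul : k n * ((k m).natAbs : ℤ) = k m * ((k n).natAbs : ℤ) := by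
    have := hk0 n
    have := hk0 m
    rcases lt_or_ge 0 (k n) with h | h
    · rw [Int.natAbs_of_nonneg h.le, Int.natAbs_of_nonneg (hsign'.1 h).le, mul_comm]
    · rw [Int.ofNat_natAbs_of_nonpos h, Int.ofNat_natAbs_of_nonpos (by omega)]
      ring
  have e : y n * g n ^ (p n * (k m).natAbs) * (y n)⁻¹ =
      y m * g m ^ (p m * (k n).natAbs) * (y m)⁻¹ := by
    rw [pow_mul, pow_mul, ← conj_pow, hk', ← conj_pow, hk', hVnm, ← zpow_natCast,
      ← zpow_natCast, ← zpow_mul, ← zpow_mul, hmul]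
  calc g n ^ (p n * (k m).natAbs)
      = (y n)⁻¹ * (y n * g n ^ (p n * (k m).natAbs) * (y n)⁻¹) * y n := by group
    _ = _ := by rw [e]; group

/-- A group with BVC has no homomorphism to a free product whose image contains a nontrivial
element of one factor and two distinct nontrivial elements of another factor. -/
theorem HasBVC.eq_of_hom_coprodI {G : Type*} [Group G] (hG : HasBVC G) {ι : Type*}
    {M : ι → Type*} [∀ i, Group (M i)] (φ : G →* Monoid.CoprodI M) {i j : ι} (hij : i ≠ j)
    {a : M i} {b c : M j} (ha : a ≠ 1) (hb : b ≠ 1) (hc : c ≠ 1) {α β γ : G}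
    (hα : φ α = Monoid.CoprodI.of a) (hβ : φ β = Monoid.CoprodI.of b)
    (hγ : φ γ = Monoid.CoprodI.of c) : b = c := by
  classical
  by_contra hbc
  obtain ⟨n, m, hne, P, Q, hP, x, hx⟩ := hG.exists_conj_pow
    (fun n => (α * β) ^ n * (α * γ)) fun n p hp h =>
      Monoid.CoprodI.alternating_pow_ne_one hij ha hb hc hp (n := n)
        (by simpa [hα, hβ, hγ] using congrArg φ h)
  exact hne (Monoid.CoprodI.alternating_pow_not_conj hij ha hb hc hbc hP (x := φ x)
    (by simpa [hα, hβ, hγ] using congrArg φ hx))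

/-- If a free product has BVC, then each factor has at most one nontrivial element, provided that
the other one is nontrivial. -/
theorem HasBVC.coprod_eq_of_ne_one.{u, v} {A : Type u} {B : Type v} [Group A] [Group B]
    (h : HasBVC (Monoid.Coprod A B)) {a a' : A} {b b' : B} (ha : a ≠ 1) (ha' : a' ≠ 1)
    (hb : b ≠ 1) (hb' : b' ≠ 1) : a = a' ∧ b = b' := by
  -- An indexed family needs one universe, hence the lifts.
  obtain ⟨M, inst, ⟨e₁⟩, ⟨e₂⟩⟩ : ∃ (M : Bool → Type max u v) (_ : ∀ i, Group (M i)),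
      Nonempty (A ≃* M false) ∧ Nonempty (B ≃* M true) :=
    ⟨fun i => Bool.rec (ULift.{v} A) (ULift.{u} B) i,
      fun i => Bool.rec (inferInstanceAs (Group (ULift.{v} A)))
        (inferInstanceAs (Group (ULift.{u} B))) i,
      ⟨(MulEquiv.ulift : ULift.{v} A ≃* A).symm⟩, ⟨(MulEquiv.ulift : ULift.{u} B ≃* B).symm⟩⟩
  let φ : Monoid.Coprod A B →* Monoid.CoprodI M := Monoid.Coprod.lift
    (Monoid.CoprodI.of.comp e₁.toMonoidHom) (Monoid.CoprodI.of.comp e₂.toMonoidHom)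
  have hφ₁ : ∀ x : A, φ (Monoid.Coprod.inl x) = Monoid.CoprodI.of (e₁ x) := fun _ => rfl
  have hφ₂ : ∀ x : B, φ (Monoid.Coprod.inr x) = Monoid.CoprodI.of (e₂ x) := fun _ => rfl
  have h₁ : ∀ {x : A}, x ≠ 1 → e₁ x ≠ 1 := e₁.map_ne_one_iff.2
  have h₂ : ∀ {x : B}, x ≠ 1 → e₂ x ≠ 1 := e₂.map_ne_one_iff.2
  exact ⟨e₁.injective (h.eq_of_hom_coprodI φ (by decide : true ≠ false)
      (h₂ hb) (h₁ ha) (h₁ ha') (hφ₂ b) (hφ₁ a) (hφ₁ a')),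
    e₂.injective (h.eq_of_hom_coprodI φ (by decide : false ≠ true)
      (h₁ ha) (h₂ hb) (h₂ hb') (hφ₁ a) (hφ₂ b) (hφ₂ b'))⟩

/-- The free product of two groups with a single nontrivial element each is virtually cyclic. -/
theorem isVirtuallyCyclic_coprod_of_forall_eq {A B : Type*} [Group A] [Group B] {a : A} {b : B}
    (ha : a ≠ 1) (hb : b ≠ 1) (hA : ∀ x : A, x ≠ 1 → x = a) (hB : ∀ y : B, y ≠ 1 → y = b) :
    IsVirtuallyCyclic (Monoid.Coprod A B) := by
  have hai : a⁻¹ = a := hA _ (inv_ne_one.2 ha)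
  have hbi : b⁻¹ = b := hB _ (inv_ne_one.2 hb)
  let s : Monoid.Coprod A B := Monoid.Coprod.inl a
  let t : Monoid.Coprod A B := Monoid.Coprod.inr b
  have hs : s⁻¹ = s := by rw [← map_inv, hai]
  have ht : t⁻¹ = t := by rw [← map_inv, hbi]
  have hss : s * s = 1 := by
    nth_rewrite 1 [← hs]
    exact inv_mul_cancel s
  set C := Subgroup.zpowers (s * t)
  have hst : s * t ∈ C := Subgroup.mem_zpowers _
  -- The involution `s` inverts `st`. Hence `C ∪ Cs` is stable under left multiplication by `s` and
  -- `t`, so it is everything.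
  have conj : ∀ g ∈ C, s * g * s ∈ C := by
    intro g hg
    obtain ⟨k, rfl⟩ := Subgroup.mem_zpowers_iff.1 hg
    have : s * (s * t) ^ k * s = ((s * t) ^ k)⁻¹ := by
      have e : s * (s * t) * s⁻¹ = (s * t)⁻¹ := by
        rw [mul_inv_rev, hs, ht, ← mul_assoc, hss, one_mul]
      nth_rewrite 3 [← hs]
      rw [← conj_zpow, e, inv_zpow]
    rw [this]
    exact C.inv_mem (Subgroup.zpow_mem _ hst k)
  have smul_s : ∀ g, (g ∈ C ∨ g * s ∈ C) → (s * g ∈ C ∨ s * g * s ∈ C) := by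
    rintro g (h | h)
    · exact Or.inr (conj g h)
    · left
      have := conj _ h
      rwa [mul_assoc, mul_assoc g, hss, mul_one] at this
  have smul_t : ∀ g, (g ∈ C ∨ g * s ∈ C) → (t * g ∈ C ∨ t * g * s ∈ C) := by
    intro g h
    have e : t * g = s * ((s * t) * g) := by
      rw [← mul_assoc, ← mul_assoc, hss, one_mul]
    rw [e]
    refine smul_s _ (h.imp (C.mul_mem hst) fun h => ?_)
    rw [mul_assoc]
    exact C.mul_mem hst h
  have cover : ∀ g : Monoid.Coprod A B, g ∈ C ∨ g * s ∈ C := by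
    intro g
    induction g using Monoid.Coprod.induction_on' with
    | one => exact Or.inl C.one_mem
    | inl_mul x g ih =>
      by_cases hx : x = 1
      · simpa [hx] using ih
      · rw [hA x hx]; exact smul_s _ ih
    | inr_mul y g ih =>
      by_cases hy : y = 1
      · simpa [hy] using ih
      · rw [hB y hy]; exact smul_t _ ih
  refine ⟨C, inferInstance, ?_⟩
  have hfin : Finite (Monoid.Coprod A B ⧸ C) := by
    refine Set.finite_univ_iff.1
      ((Set.toFinite {((1 : Monoid.Coprod A B) : _ ⧸ C), (s : _ ⧸ C)}).subset ?_)
    rintro ⟨g⟩ -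
    change (g : Monoid.Coprod A B ⧸ C) ∈ _
    -- The inverse passes from right cosets to the left cosets of the quotient.
    rcases cover g⁻¹ with h | h
    · exact Or.inl (QuotientGroup.eq.2 (by simpa using h))
    · exact Or.inr (QuotientGroup.eq.2 h)
  exact Subgroup.finiteIndex_of_finite_quotient

theorem IsVirtuallyCyclic.hasBVC {G : Type*} [Group G] (h : IsVirtuallyCyclic G) : HasBVC G := by
  obtain ⟨C, hC, hfin⟩ := h
  refine ⟨{⊤}, Set.finite_singleton _, ?_, fun H _ => ⟨⊤, rfl, 1, le_top⟩⟩
  rintro V rfl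
  refine ⟨C.subgroupOf ⊤, ?_, inferInstance⟩
  exact (Subgroup.subgroupOfEquivOfLe (le_top : C ≤ ⊤)).isCyclic.2 hC

theorem mainTheorem10 {A B : Type*} [Group A] [Group B] [Nontrivial A] [Nontrivial B] :
    HasBVC (Monoid.Coprod A B) ↔ IsVirtuallyCyclic (Monoid.Coprod A B) := by
  refine ⟨fun h => ?_, IsVirtuallyCyclic.hasBVC⟩
  obtain ⟨a, ha⟩ := exists_ne (1 : A)
  obtain ⟨b, hb⟩ := exists_ne (1 : B)
  exact isVirtuallyCyclic_coprod_of_forall_eq ha hb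
    (fun x hx => (h.coprod_eq_of_ne_one hx ha hb hb).1)
    (fun y hy => (h.coprod_eq_of_ne_one ha ha hy hb).2)
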